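/- A POVM on $\mathbb C^n$ is a finite family $\mathrm M=(M_i)_{i\in I}$ of positive semidefinite operators with $\sum_i M_i=\mathrm{Id}$; for Hermitian $\Delta$ put $\|\Delta\|_{\mathrm M}=\sum_{i}|\mathrm{tr}(M_i\Delta)|$, and for a class $\mathbf M$ of POVMs put $\|\Delta\|_{\mathbf M}=\sup_{\mathrm M\in\mathbf M}\|\Delta\|_{\mathrm M}$. On $\mathbb C^d\otimes\mathbb C^d$, let $\mathbf{LO}$ be the class of POVMs $(M_i\otimes N_j)_{i\in I,j\in J}$ with $(M_i)_{i\in I}$ and $(N_j)_{j\in J}$ POVMs on $\mathbb C^d$, and let $\mathbf{LOCC}^{\to}$ be the class of POVMs $(M_i\otimes N_{i,j})_{i\in I,j\in J_i}$ with $(M_i)_{i\in I}$ a POVM on $\mathbb C^d$ and, for each $i\in I$, $(N_{i,j})_{j\in J_i}$ a POVM on $\mathbb C^d$. A state is a positive semidefinite operator of trace one. There are universal constants $C,c_0>0$ such that the following holds. (1) For every $d\ge 2$ there are states $\rho,\sigma$ on $\mathbb C^d\otimes\mathbb C^d$ with $$\|\rho-\sigma\|_{\mathbf{LOCC}^{\to}}=2\qquad\text{and}\qquad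 \|\rho-\sigma\|_{\mathbf{LO}}\le \frac{C}{\sqrt d}.$$ (2) Let $d\ge 2$ be even, let $E\subset\mathbb C^d$ be a subspace of dimension $d/2$, let $P_E$ and $P_{E^\perp}$ be the orthogonal projections onto $E$ and $E^\perp$, and let $|1\rangle,\dots,|d\rangle$ be an orthonormal basis of $\mathbb C^d$. For unitaries $U_1,\dots,U_d$ on $\mathbb C^d$ put $$\rho=\frac1d\sum_{i=1}^d|i\rangle\langle i|\otimes U_i\frac{P_E}{d/2}U_i^\dagger,\qquad \sigma=\frac1d\sum_{i=1}^d|i\rangle\langle i|\otimes U_i\frac{P_{E^\perp}}{d/2}U_i^\dagger .$$ Then $\rho$ and $\sigma$ are states and $\|\rho-\sigma\|_{\mathbf{LOCC}^{\to}}=2$. Moreover, if $U_1,\dots,U_d$ are random, independent and Haar distributed on the unitary group of $\mathbb C^d$, then the probability that $\|\rho-\sigma\|_{\mathbf{LO}}\le C/\sqrt d$ fails is less than $\exp(-c_0 d)$. -/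

import Mathlib

open MeasureTheory ProbabilityTheory
open scoped ComplexOrder Kronecker Matrix

noncomputable section

/-! Operators on `ℂ^n` are `n × n` complex matrices; operators on `ℂ^d ⊗ ℂ^d` are matrices indexed
by `Fin d × Fin d`, and the tensor product of operators is the Kronecker product. -/

/-- Density operators: positive semidefinite of trace one. -/
def IsState {n : Type} [Fintype n] (ρ : Matrix n n ℂ) : Prop :=
  ρ.PosSemidef ∧ ρ.trace = 1

/-- A POVM: a finite family of positive operators summing to the identity. -/
structure POVM (n : Type) [Fintype n] [DecidableEq n] where
  outcome : Type
  [fintypeOutcome : Fintype outcome]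
  effect : outcome → Matrix n n ℂ
  posSemidef : ∀ i, (effect i).PosSemidef
  sum_eq_one : ∑ i, effect i = 1

attribute [instance] POVM.fintypeOutcome

namespace POVM

variable {n m : Type} [Fintype n] [DecidableEq n] [Fintype m] [DecidableEq m]

/-- The measurement seminorm `‖Δ‖_M = ∑ i, |tr (M_i Δ)|` of a single POVM. -/
def seminorm (M : POVM n) (Δ : Matrix n n ℂ) : ℝ :=
  ∑ i, ‖(M.effect i * Δ).trace‖

/-- The one-way adaptive POVM `(M_i ⊗ N_{i,j})`, `i ∈ I`, `j ∈ J_i`: the first party measures `M`,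
obtains `i`, and the second party then measures the POVM `N i`. -/
def oneWay (M : POVM n) (N : M.outcome → POVM m) : POVM (n × m) where
  outcome := Σ i : M.outcome, (N i).outcome
  effect p := M.effect p.1 ⊗ₖ (N p.1).effect p.2
  posSemidef p := (M.posSemidef p.1).kronecker ((N p.1).posSemidef p.2)
  sum_eq_one := by
    rw [Fintype.sum_sigma]
    have h : ∀ i, ∑ j, M.effect i ⊗ₖ (N i).effect j = M.effect i ⊗ₖ (1 : Matrix m m ℂ) := by
      intro i
      rw [← (N i).sum_eq_one]
      ext a b
      simp [Matrix.sum_apply, Finset.mul_sum]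
    simp only [h]
    rw [← Matrix.one_kronecker_one, ← M.sum_eq_one]
    ext a b
    simp only [Matrix.sum_apply, Matrix.kroneckerMap_apply, Finset.sum_mul]

/-- The product POVM `(M_i ⊗ N_j)`, `i ∈ I`, `j ∈ J`. -/
def tensor (M : POVM n) (N : POVM m) : POVM (n × m) where
  outcome := M.outcome × N.outcome
  effect p := M.effect p.1 ⊗ₖ N.effect p.2
  posSemidef p := (M.posSemidef p.1).kronecker (N.posSemidef p.2)
  sum_eq_one := by
    rw [Fintype.sum_prod_type, ← Matrix.one_kronecker_one, ← M.sum_eq_one, ← N.sum_eq_one]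
    ext a b
    simp only [Matrix.sum_apply, Matrix.kroneckerMap_apply, Finset.sum_mul_sum]

end POVM

/-- The class of local measurements on `ℂ^d ⊗ ℂ^d`. -/
def LO (d : ℕ) : Set (POVM (Fin d × Fin d)) :=
  {T | ∃ M N : POVM (Fin d), T = M.tensor N}

/-- The class of one-way LOCC measurements on `ℂ^d ⊗ ℂ^d`
(classical communication from the first party to the second). -/
def LOCCOneWay (d : ℕ) : Set (POVM (Fin d × Fin d)) :=
  {T | ∃ (M : POVM (Fin d)) (N : M.outcome → POVM (Fin d)), T = M.oneWay N}

/-- The distinguishability norm of a class of POVMs, `‖Δ‖ = sup_{M ∈ 𝓜} ‖Δ‖_M`.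
The set is always bounded above, see `bddAbove_seminorm`. -/
def distNorm {n : Type} [Fintype n] [DecidableEq n] (𝓜 : Set (POVM n)) (Δ : Matrix n n ℂ) : ℝ :=
  sSup ((fun M : POVM n => M.seminorm Δ) '' 𝓜)

theorem norm_entry_le_trace {n : Type} [Fintype n] [DecidableEq n] {A : Matrix n n ℂ}
    (hA : A.PosSemidef) (i j : n) : ‖A i j‖ ≤ A.trace.re := by
  have hd : ∀ k, 0 ≤ (A k k).re ∧ (A k k).im = 0 := fun k => by
    have h := (Complex.le_def.1 (hA.diag_nonneg (i := k)))
    exact ⟨by simpa using h.1, by simpa using h.2.symm⟩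
  have hle : ∀ k, (A k k).re ≤ A.trace.re := fun k => by
    rw [Matrix.trace, Complex.re_sum]
    exact Finset.single_le_sum (f := fun k => (A.diag k).re) (fun l _ => (hd l).1)
      (Finset.mem_univ k)
  have h := (hA.submatrix ![i, j]).det_nonneg
  rw [Matrix.det_fin_two] at h
  have hji : A j i = star (A i j) := (hA.1.apply j i).symm
  have h2 := (Complex.le_def.1 h).1
  simp [hji, (hd i).2, (hd j).2] at h2
  have h3 : ‖A i j‖ ^ 2 ≤ A.trace.re ^ 2 := by
    rw [← Complex.normSq_eq_norm_sq, Complex.normSq_apply]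
    nlinarith [hle i, hle j, (hd i).1, (hd j).1]
  exact abs_le_of_sq_le_sq' h3 ((hd i).1.trans (hle i)) |>.2

theorem bddAbove_seminorm {n : Type} [Fintype n] [DecidableEq n] (𝓜 : Set (POVM n))
    (Δ : Matrix n n ℂ) : BddAbove ((fun M : POVM n => M.seminorm Δ) '' 𝓜) := by
  refine ⟨(Fintype.card n : ℝ) * ∑ j, ∑ k, ‖Δ k j‖, ?_⟩
  rintro _ ⟨M, -, rfl⟩
  have h1 : ∀ i, ‖(M.effect i * Δ).trace‖ ≤ (M.effect i).trace.re * ∑ j, ∑ k, ‖Δ k j‖ := by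
    intro i
    rw [Matrix.trace_mul_comm]
    simp only [Matrix.trace, Matrix.diag_apply, Matrix.mul_apply, Finset.mul_sum]
    rw [Finset.sum_comm]
    refine (norm_sum_le _ _).trans (Finset.sum_le_sum fun j _ => ?_)
    refine (norm_sum_le _ _).trans (Finset.sum_le_sum fun k _ => ?_)
    rw [norm_mul, mul_comm]
    exact mul_le_mul_of_nonneg_right (norm_entry_le_trace (M.posSemidef i) j k) (norm_nonneg _)
  have h2 : ∑ i, (M.effect i).trace.re = Fintype.card n := by
    rw [← Complex.re_sum, ← Matrix.trace_sum, M.sum_eq_one]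
    simp
  calc M.seminorm Δ ≤ ∑ i, (M.effect i).trace.re * ∑ j, ∑ k, ‖Δ k j‖ :=
        Finset.sum_le_sum fun i _ => h1 i
    _ = _ := by rw [← Finset.sum_mul, h2]

/-! Haar probability measure on the unitary group `U(d)`, with its Borel `σ`-algebra. -/

instance unitaryMeasurableSpace (d : ℕ) : MeasurableSpace (Matrix.unitaryGroup (Fin d) ℂ) :=
  borel _

instance unitaryBorelSpace (d : ℕ) : BorelSpace (Matrix.unitaryGroup (Fin d) ℂ) := ⟨rfl⟩

instance unitaryCompactSpace (d : ℕ) : CompactSpace (Matrix.unitaryGroup (Fin d) ℂ) := by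
  have hK := isCompact_univ_pi (X := fun _ : Fin d => Fin d → ℂ)
    (s := fun _ => Set.univ.pi fun _ => Metric.closedBall (0 : ℂ) 1)
    fun _ => isCompact_univ_pi fun _ => isCompact_closedBall _ _
  have hclosed : IsClosed {A : Matrix (Fin d) (Fin d) ℂ | A * star A = 1} :=
    isClosed_eq (by fun_prop) continuous_const
  refine isCompact_iff_compactSpace.1 (hK.of_isClosed_subset ?_ ?_)
  · have heq : (Matrix.unitaryGroup (Fin d) ℂ : Set (Matrix (Fin d) (Fin d) ℂ)) =
        {A | A * star A = 1} := Set.ext fun A => Matrix.mem_unitaryGroup_iff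
    rw [heq]
    exact hclosed
  · intro A hA i _ j _
    simpa using entry_norm_bound_of_unitary hA i j

/-- The Haar measure on `U(d)`, normalized to have total mass one. -/
def haarUnitary (d : ℕ) : Measure (Matrix.unitaryGroup (Fin d) ℂ) :=
  Measure.haarMeasure ⟨⟨Set.univ, isCompact_univ⟩, by simp⟩

/-- The matrix, in the standard basis, of the orthogonal projection `P_E`. -/
def projMatrix {d : ℕ} (E : Submodule ℂ (EuclideanSpace ℂ (Fin d))) : Matrix (Fin d) (Fin d) ℂ :=
  (Matrix.toEuclideanCLM (n := Fin d) (𝕜 := ℂ)).symm E.starProjection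

/-- The rank-one operator `|v⟩⟨v|`. -/
def ketbra {d : ℕ} (v : EuclideanSpace ℂ (Fin d)) : Matrix (Fin d) (Fin d) ℂ :=
  Matrix.vecMulVec v.ofLp (star v.ofLp)

/-- The operator `(1/d) ∑ i, |i⟩⟨i| ⊗ U_i (P_E / (d/2)) U_i†` on `ℂ^d ⊗ ℂ^d`. -/
def ensembleState {d : ℕ} (b : OrthonormalBasis (Fin d) ℂ (EuclideanSpace ℂ (Fin d)))
    (E : Submodule ℂ (EuclideanSpace ℂ (Fin d))) (U : Fin d → Matrix.unitaryGroup (Fin d) ℂ) :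
    Matrix (Fin d × Fin d) (Fin d × Fin d) ℂ :=
  (1 / (d : ℂ)) • ∑ i, ketbra (b i) ⊗ₖ
    ((U i : Matrix (Fin d) (Fin d) ℂ) * ((1 / ((d : ℂ) / 2)) • projMatrix E) *
      (U i : Matrix (Fin d) (Fin d) ℂ)ᴴ)

end

/-! One-way communication reveals `i` to the second party, who can then separate the orthogonal
supports of `U_i p U_i†` and `U_i q U_i†` perfectly. Here `p`, `q` are orthogonal projections of
rank `m`, about `d/2`. Hence the value 2, the largest possible for two states.

Without communication the second party must choose one measurement for all `i`. Put `S = p - q`. The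
outcome probabilities of the first party, given `i`, sum to one, so they drop out. Splitting the
effects of the second party into rank-one pieces of total trace `d` bounds the LO norm by `(1/m)
sup_ψ ∑ i, |⟨ψ|U_i S U_i†|ψ⟩|` over unit vectors (`distNorm_LO_ensemble_le`). A typical summand has
size `1/√d`, so the sum should be of order `√d` and the norm of order `1/√d`.

For fixed `ψ`, the exponential moment of `X = ⟨ψ|U S U†|ψ⟩` comes from evaluating one Gaussian
integral in two ways (`lintegral_exp_qf_le`). Since `tr S = 0`, this gives `E exp(t d X) ≤ exp(2 t²
d)`. Independence and Chernoff's inequality then make a sum above `12√d` have probability at most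
`(2 e^(-11/2))^d`. A union bound over a net of `25^d` points still leaves less than `e^(-d)`
(`measureReal_lt`), and a bound on the net extends to the whole sphere with a factor 32
(`sum_abs_qf_le_of_net`). Part (1) follows because an event of probability below one cannot be
everything. -/

noncomputable section

/-- The real part of the quadratic form `⟨v|S|v⟩`. -/
def qf {n : Type} [Fintype n] (S : Matrix n n ℂ) (v : n → ℂ) : ℝ := (star v ⬝ᵥ S *ᵥ v).re

/-! ### Quadratic forms -/

section QuadraticForm

variable {n : Type} [Fintype n]

theorem qf_smul (S : Matrix n n ℂ) (c : ℂ) (v : n → ℂ) : qf S (c • v) = ‖c‖ ^ 2 * qf S v := by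
  have h : star c * c = ((‖c‖ ^ 2 : ℝ) : ℂ) := by
    rw [Complex.star_def, ← Complex.normSq_eq_conj_mul_self, Complex.normSq_eq_norm_sq]
  rw [qf, star_smul, Matrix.mulVec_smul, smul_dotProduct, dotProduct_smul, smul_smul, h, smul_eq_mul,
    Complex.re_ofReal_mul, qf]

theorem qf_mulVec (S M : Matrix n n ℂ) (v : n → ℂ) : qf S (M *ᵥ v) = qf (Mᴴ * S * M) v := by
  rw [qf, qf, Matrix.star_mulVec, ← Matrix.dotProduct_mulVec, Matrix.mulVec_mulVec,
    Matrix.mulVec_mulVec, Matrix.mul_assoc]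

theorem qf_diagonal [DecidableEq n] (s : n → ℝ) (v : n → ℂ) :
    qf (Matrix.diagonal fun j => (s j : ℂ)) v = ∑ j, s j * ‖v j‖ ^ 2 := by
  rw [qf, dotProduct, Complex.re_sum]
  refine Finset.sum_congr rfl fun j _ => ?_
  rw [Matrix.mulVec_diagonal, ← Complex.normSq_eq_norm_sq, Complex.normSq_apply]
  simp
  ring

theorem qf_one [DecidableEq n] (v : n → ℂ) : qf 1 v = ∑ j, ‖v j‖ ^ 2 := by
  have := qf_diagonal (n := n) (fun _ => 1) v
  simpa using this

theorem qf_one_nonneg [DecidableEq n] (v : n → ℂ) : 0 ≤ qf 1 v := by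
  rw [qf_one]; positivity

theorem qf_one_unitary [DecidableEq n] {W : Matrix n n ℂ} (hW : W ∈ Matrix.unitaryGroup n ℂ)
    (v : n → ℂ) : qf 1 (W *ᵥ v) = qf 1 v := by
  rw [qf_mulVec, mul_one, ← Matrix.star_eq_conjTranspose, Matrix.mem_unitaryGroup_iff'.1 hW]

theorem qf_sub (S T : Matrix n n ℂ) (v : n → ℂ) : qf (S - T) v = qf S v - qf T v := by
  simp [qf, Matrix.sub_mulVec, dotProduct_sub]

@[fun_prop]
theorem continuous_qf (S : Matrix n n ℂ) : Continuous (qf S) := by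
  unfold qf
  fun_prop

end QuadraticForm

/-! ### Gaussian integrals and unitary changes of variables -/

theorem lintegral_gaussian_pi {d : ℕ} (c : Fin d → ℝ) (hc : ∀ j, 0 < c j) :
    ∫⁻ v : Fin d → ℂ, ENNReal.ofReal (Real.exp (-∑ j, c j * ‖v j‖ ^ 2)) =
      ENNReal.ofReal (∏ j, (Real.pi / c j)) := by
  have h1 : ∀ j, ∫ z : ℂ, Real.exp (-c j * ‖z‖ ^ 2) = Real.pi / c j := fun j => by
    rw [GaussianFourier.integral_rexp_neg_mul_sq_norm (hc j), Complex.finrank_real_complex]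
    norm_num
  have hint : ∀ j, Integrable fun z : ℂ => Real.exp (-c j * ‖z‖ ^ 2) := fun j => by
    -- A non-integrable function has integral 0 by convention, contradicting the positive value in
    -- `h1`.
    by_contra h
    have := h1 j
    rw [integral_undef h] at this
    have := div_pos Real.pi_pos (hc j)
    linarith
  have h2 : ∀ v : Fin d → ℂ, Real.exp (-∑ j, c j * ‖v j‖ ^ 2) =
      ∏ j, Real.exp (-c j * ‖v j‖ ^ 2) := fun v => by
    rw [← Real.exp_sum, ← Finset.sum_neg_distrib]
    simp
  simp only [h2]
  rw [← ofReal_integral_eq_lintegral_ofReal, integral_fintype_prod_volume_eq_prod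
    (fun j (z : ℂ) => Real.exp (-c j * ‖z‖ ^ 2))]
  · simp only [h1]
  · exact Integrable.fintype_prod hint
  · exact Filter.Eventually.of_forall fun v => by positivity

theorem measurePreserving_mulVec_unitary {d : ℕ} {W : Matrix (Fin d) (Fin d) ℂ}
    (hW : W ∈ Matrix.unitaryGroup (Fin d) ℂ) :
    MeasurePreserving (fun v : Fin d → ℂ => W *ᵥ v) := by
  have hdet : ‖W.det‖ = 1 := by
    have := Matrix.det_of_mem_unitary hW
    exact CStarRing.norm_of_mem_unitary this
  -- The real determinant of a complex-linear map is `|det W|²`.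
  have hd : ((Matrix.toLin' W).restrictScalars ℝ).det = 1 := by
    rw [LinearMap.det_restrictScalars, LinearMap.det_toLin', Algebra.norm_complex_eq]
    simp [Complex.normSq_eq_norm_sq, hdet]
  refine ⟨by fun_prop, ?_⟩
  have := Measure.map_linearMap_addHaar_eq_smul_addHaar (volume : Measure (Fin d → ℂ))
    (f := (Matrix.toLin' W).restrictScalars ℝ) (by rw [hd]; exact one_ne_zero)
  rw [hd] at this
  simpa using! this

theorem exists_unitary_mulVec_single {d : ℕ} (i₀ : Fin d) (v : Fin d → ℂ) (hv : qf 1 v = 1) :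
    ∃ W ∈ Matrix.unitaryGroup (Fin d) ℂ, W *ᵥ Pi.single i₀ 1 = v := by
  have hv' : ‖WithLp.toLp 2 v‖ = 1 := by
    rw [EuclideanSpace.norm_eq]
    simp [← qf_one, hv]
  obtain ⟨b, hb⟩ := Orthonormal.exists_orthonormalBasis_extension_of_card_eq (𝕜 := ℂ)
    (E := EuclideanSpace ℂ (Fin d)) (ι := Fin d) (by simp) (v := fun _ => WithLp.toLp 2 v)
    (s := {i₀}) ⟨fun _ => hv', fun i j hij => (hij (Subsingleton.elim _ _)).elim⟩
  refine ⟨(EuclideanSpace.basisFun (Fin d) ℂ).toBasis.toMatrix b.toBasis,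
    (EuclideanSpace.basisFun (Fin d) ℂ).toMatrix_orthonormalBasis_mem_unitary b, ?_⟩
  ext i
  simp [Module.Basis.toMatrix_apply, hb i₀ rfl]

/-- The unitary group is transitive on spheres: go through a fixed basis vector. At `g = 0` the
scaled vector vanishes as well, and `W = 1` serves. -/
theorem exists_unitary_mulVec_eq {d : ℕ} (ψ : Fin d → ℂ) (hψ : qf 1 ψ = 1) (g : Fin d → ℂ) :
    ∃ W ∈ Matrix.unitaryGroup (Fin d) ℂ, W *ᵥ ((√(qf 1 g) : ℂ) • ψ) = g := by
  rcases (qf_one_nonneg g).eq_or_lt with h0 | h0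
  · refine ⟨1, one_mem _, ?_⟩
    rw [← h0]
    have : ∀ j, g j = 0 := by
      rw [qf_one, eq_comm, Finset.sum_eq_zero_iff_of_nonneg fun _ _ => by positivity] at h0
      simpa using h0
    ext j
    simp [this]
  · have hs : (√(qf 1 g) : ℂ) ≠ 0 := by
      simpa using (Real.sqrt_pos.2 h0).ne'
    have hd : Nonempty (Fin d) := by
      by_contra h
      rw [not_nonempty_iff] at h
      simp [qf_one] at hψ
    obtain ⟨i₀⟩ := hd
    obtain ⟨V, hV, hVψ⟩ := exists_unitary_mulVec_single i₀ ψ hψ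
    obtain ⟨W, hW, hWg⟩ := exists_unitary_mulVec_single i₀ ((√(qf 1 g) : ℂ)⁻¹ • g) (by
      rw [qf_smul, norm_inv, Complex.norm_real, Real.norm_of_nonneg (Real.sqrt_nonneg _), inv_pow,
        Real.sq_sqrt h0.le, inv_mul_cancel₀ h0.ne'])
    refine ⟨W * star V, mul_mem hW (Unitary.star_mem hV), ?_⟩
    rw [Matrix.mulVec_smul, ← Matrix.mulVec_mulVec, ← hVψ, Matrix.mulVec_mulVec _ (star V),
      Matrix.mem_unitaryGroup_iff'.1 hV, Matrix.one_mulVec, hWg, smul_smul, mul_inv_cancel₀ hs,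
      one_smul]

/-- Traceless Hermitian contractions. -/
structure IsTracelessContraction {d : ℕ} (S : Matrix (Fin d) (Fin d) ℂ) : Prop where
  isHermitian : S.IsHermitian
  trace_eq_zero : S.trace = 0
  abs_qf_le : ∀ v, |qf S v| ≤ qf 1 v

namespace IsTracelessContraction

variable {d : ℕ} {S : Matrix (Fin d) (Fin d) ℂ}

theorem exists_diagonalization (hS : IsTracelessContraction S) :
    ∃ W ∈ Matrix.unitaryGroup (Fin d) ℂ, ∃ s : Fin d → ℝ,
      Wᴴ * S * W = Matrix.diagonal (fun j => (s j : ℂ)) ∧ ∑ j, s j = 0 ∧ ∀ j, |s j| ≤ 1 := by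
  have h := hS.isHermitian.conjStarAlgAut_star_eigenvectorUnitary
  rw [Unitary.conjStarAlgAut_star_apply] at h
  have h' : (hS.isHermitian.eigenvectorUnitary : Matrix (Fin d) (Fin d) ℂ)ᴴ * S *
    hS.isHermitian.eigenvectorUnitary =
      Matrix.diagonal (fun j => (hS.isHermitian.eigenvalues j : ℂ)) := h
  refine ⟨hS.isHermitian.eigenvectorUnitary, hS.isHermitian.eigenvectorUnitary.2,
    hS.isHermitian.eigenvalues, h', ?_, fun j => ?_⟩
  · have := hS.isHermitian.trace_eq_sum_eigenvalues
    rw [hS.trace_eq_zero] at this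
    rw [← Complex.ofReal_inj, Complex.ofReal_sum]
    simpa using this.symm
  · have h1 := hS.abs_qf_le (hS.isHermitian.eigenvectorUnitary *ᵥ Pi.single j 1)
    rw [qf_one_unitary hS.isHermitian.eigenvectorUnitary.2, qf_mulVec, h', qf_diagonal, qf_one] at h1
    simpa [Pi.single_apply, apply_ite] using h1

/-- In an eigenbasis of `S` the integral is `∏ π / (1 - t s_j)`. The zero trace cancels the
first-order term in `t`, leaving only `t²` in the exponent. -/
theorem lintegral_gaussian_le (hS : IsTracelessContraction S) {t : ℝ} (ht : |t| ≤ 1 / 2) :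
    ∫⁻ v : Fin d → ℂ, ENNReal.ofReal (Real.exp (-(qf 1 v - t * qf S v))) ≤
      ENNReal.ofReal (Real.pi ^ d * Real.exp (2 * t ^ 2 * d)) := by
  obtain ⟨W, hW, s, hs, hsum, hle⟩ := hS.exists_diagonalization
  have hts : ∀ j, |t * s j| ≤ 1 / 2 := fun j => by
    rw [abs_mul]
    nlinarith [hle j, abs_nonneg t, abs_nonneg (s j)]
  have hpos : ∀ j, 0 < 1 - t * s j := fun j => by
    linarith [(abs_le.1 (hts j)).2]
  rw [← (measurePreserving_mulVec_unitary hW).lintegral_comp (by fun_prop)]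
  have h1 : ∀ v, qf 1 (W *ᵥ v) - t * qf S (W *ᵥ v) = ∑ j, (1 - t * s j) * ‖v j‖ ^ 2 := fun v => by
    rw [qf_one_unitary hW, qf_mulVec, hs, qf_diagonal, qf_one, Finset.mul_sum,
      ← Finset.sum_sub_distrib]
    exact Finset.sum_congr rfl fun j _ => by ring
  simp only [h1]
  rw [lintegral_gaussian_pi _ hpos]
  refine ENNReal.ofReal_le_ofReal ?_
  have h2 : ∀ j, Real.pi / (1 - t * s j) ≤ Real.pi * Real.exp (t * s j + 2 * t ^ 2) := fun j => by
    rw [div_le_iff₀ (hpos j), mul_assoc]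
    refine le_mul_of_one_le_right Real.pi_pos.le ?_
    set x := t * s j with hx
    have hx2 : x ^ 2 ≤ t ^ 2 := by
      rw [hx, mul_pow]
      have : s j ^ 2 ≤ 1 := (sq_le_one_iff_abs_le_one _).2 (hle j)
      nlinarith [sq_nonneg t]
    have hxa := abs_le.1 (hts j)
    have h3 := Real.add_one_le_exp (x + 2 * t ^ 2)
    -- The product is `1 + x² (1 - 2x)`, and `x ≤ 1/2`.
    calc (1 : ℝ) ≤ (x + 2 * x ^ 2 + 1) * (1 - x) := by nlinarith [sq_nonneg x]
      _ ≤ _ := mul_le_mul_of_nonneg_right (by linarith) (hpos j).le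
  calc ∏ j, Real.pi / (1 - t * s j) ≤ ∏ j, Real.pi * Real.exp (t * s j + 2 * t ^ 2) :=
        Finset.prod_le_prod (fun j _ => (div_pos Real.pi_pos (hpos j)).le) fun j _ => h2 j
    _ = _ := by
        rw [Finset.prod_mul_distrib, ← Real.exp_sum, Finset.sum_add_distrib, ← Finset.mul_sum, hsum]
        simp [mul_comm]

end IsTracelessContraction
end
-- Concentration for Haar unitaries
noncomputable section

instance isProbabilityMeasure_haarUnitary (d : ℕ) : IsProbabilityMeasure (haarUnitary d) :=
  ⟨Measure.haarMeasure_self⟩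

instance isMulLeftInvariant_haarUnitary (d : ℕ) : (haarUnitary d).IsMulLeftInvariant :=
  inferInstanceAs (Measure.haarMeasure _).IsMulLeftInvariant

theorem norm_sq_toLp {d : ℕ} (v : Fin d → ℂ) : ‖WithLp.toLp 2 v‖ ^ 2 = qf 1 v := by
  rw [EuclideanSpace.norm_sq_eq, qf_one]

theorem continuous_qf_conjTranspose_mulVec {d : ℕ} (S : Matrix (Fin d) (Fin d) ℂ) :
    Continuous fun p : Matrix.unitaryGroup (Fin d) ℂ × (Fin d → ℂ) =>
      qf S ((p.1 : Matrix (Fin d) (Fin d) ℂ)ᴴ *ᵥ p.2) := by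
  have h1 : Continuous fun p : Matrix.unitaryGroup (Fin d) ℂ × (Fin d → ℂ) =>
      (p.1 : Matrix (Fin d) (Fin d) ℂ) := continuous_subtype_val.comp continuous_fst
  exact (continuous_qf S).comp (h1.matrix_conjTranspose.matrix_mulVec continuous_snd)

theorem continuous_qf_conjTranspose_mulVec_left {d : ℕ} (S : Matrix (Fin d) (Fin d) ℂ)
    (v : Fin d → ℂ) : Continuous fun U : Matrix.unitaryGroup (Fin d) ℂ =>
      qf S ((U : Matrix (Fin d) (Fin d) ℂ)ᴴ *ᵥ v) := by
  have h1 : Continuous fun U : Matrix.unitaryGroup (Fin d) ℂ =>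
      (U : Matrix (Fin d) (Fin d) ℂ) := continuous_subtype_val
  exact (continuous_qf S).comp (h1.matrix_conjTranspose.matrix_mulVec continuous_const)

theorem conjTranspose_mem_unitaryGroup {d : ℕ} (U : Matrix.unitaryGroup (Fin d) ℂ) :
    (U : Matrix (Fin d) (Fin d) ℂ)ᴴ ∈ Matrix.unitaryGroup (Fin d) ℂ :=
  Unitary.star_mem U.2

/-- The orbit of `v` under a Haar distributed unitary depends on `v` through its norm alone. -/
theorem lintegral_haarUnitary_mulVec {d : ℕ} (S : Matrix (Fin d) (Fin d) ℂ) (ψ : Fin d → ℂ)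
    (hψ : qf 1 ψ = 1) (v : Fin d → ℂ) (h : ℝ → ENNReal) :
    ∫⁻ U, h (qf S ((U : Matrix (Fin d) (Fin d) ℂ)ᴴ *ᵥ v)) ∂haarUnitary d =
      ∫⁻ U, h (qf 1 v * qf S ((U : Matrix (Fin d) (Fin d) ℂ)ᴴ *ᵥ ψ)) ∂haarUnitary d := by
  obtain ⟨W, hW, hWv⟩ := exists_unitary_mulVec_eq ψ hψ v
  -- Replace `U` by `W * U`, where `W` carries `‖v‖ψ` to `v`; then `(W U)† v = ‖v‖ U† ψ`.
  rw [← lintegral_mul_left_eq_self _ (⟨W, hW⟩ : Matrix.unitaryGroup (Fin d) ℂ)]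
  refine lintegral_congr fun U => ?_
  have h1 : (((⟨W, hW⟩ * U : Matrix.unitaryGroup (Fin d) ℂ) : Matrix (Fin d) (Fin d) ℂ))ᴴ *ᵥ v =
      (√(qf 1 v) : ℂ) • ((U : Matrix (Fin d) (Fin d) ℂ)ᴴ *ᵥ ψ) := by
    have hWW : Wᴴ * W = 1 := Matrix.mem_unitaryGroup_iff'.1 hW
    have h2 : Wᴴ *ᵥ v = (√(qf 1 v) : ℂ) • ψ := by
      conv_lhs => rw [← hWv]
      rw [Matrix.mulVec_mulVec, hWW, Matrix.one_mulVec]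
    rw [Submonoid.coe_mul, Matrix.conjTranspose_mul, ← Matrix.mulVec_mulVec, h2,
      Matrix.mulVec_smul]
  rw [h1, qf_smul, Complex.norm_real, Real.norm_of_nonneg (Real.sqrt_nonneg _),
    Real.sq_sqrt (qf_one_nonneg v)]

namespace IsTracelessContraction

variable {d : ℕ} {S : Matrix (Fin d) (Fin d) ℂ}

theorem abs_qf_conjTranspose_mulVec_le (hS : IsTracelessContraction S)
    (U : Matrix.unitaryGroup (Fin d) ℂ) (v : Fin d → ℂ) :
    |qf S ((U : Matrix (Fin d) (Fin d) ℂ)ᴴ *ᵥ v)| ≤ qf 1 v :=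
  (hS.abs_qf_le _).trans_eq (qf_one_unitary (conjTranspose_mem_unitaryGroup U) v)

/-- Haar averaging does not change the Gaussian integral of `exp(-(‖v‖² - t ⟨v|S|v⟩))`, and it lets
`v` be replaced by `‖v‖ψ`. What remains is an isotropic Gaussian with parameter `1 - tX`, whose
integral `(π / (1 - tX))^d` dominates `π^d exp(t d X)`. -/
theorem lintegral_exp_qf_le (hS : IsTracelessContraction S) {t : ℝ} (ht : |t| ≤ 1 / 2)
    (ψ : Fin d → ℂ) (hψ : qf 1 ψ = 1) :
    ∫⁻ U, ENNReal.ofReal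
      (Real.exp (t * d * qf S ((U : Matrix (Fin d) (Fin d) ℂ)ᴴ *ᵥ ψ))) ∂haarUnitary d ≤
      ENNReal.ofReal (Real.exp (2 * t ^ 2 * d)) := by
  set X : Matrix.unitaryGroup (Fin d) ℂ → ℝ := fun U =>
    qf S ((U : Matrix (Fin d) (Fin d) ℂ)ᴴ *ᵥ ψ) with hX
  have hXc : Continuous X := continuous_qf_conjTranspose_mulVec_left S ψ
  have hX1 : ∀ U, t * X U ≤ 1 / 2 := fun U => by
    have h1 := hS.abs_qf_conjTranspose_mulVec_le U ψ
    rw [hψ] at h1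
    calc t * X U ≤ |t * X U| := le_abs_self _
      _ = |t| * |X U| := abs_mul _ _
      _ ≤ 1 / 2 * 1 := mul_le_mul ht h1 (abs_nonneg _) (by norm_num)
      _ = 1 / 2 := by norm_num
  have hcont := continuous_qf_conjTranspose_mulVec S
  have key : ∫⁻ U, ENNReal.ofReal ((Real.pi / (1 - t * X U)) ^ d) ∂haarUnitary d =
      ∫⁻ v : Fin d → ℂ, ENNReal.ofReal (Real.exp (-(qf 1 v - t * qf S v))) := by
    calc ∫⁻ U, ENNReal.ofReal ((Real.pi / (1 - t * X U)) ^ d) ∂haarUnitary d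
        = ∫⁻ U, (∫⁻ v : Fin d → ℂ,
            ENNReal.ofReal (Real.exp (-(qf 1 v - t * (qf 1 v * X U))))) ∂haarUnitary d := by
          refine lintegral_congr fun U => ?_
          have h1 := lintegral_gaussian_pi (d := d) (fun _ => 1 - t * X U)
            fun _ => by linarith [hX1 U]
          rw [Finset.prod_const, Finset.card_univ, Fintype.card_fin] at h1
          rw [← h1]
          refine lintegral_congr fun v => ?_
          rw [← Finset.mul_sum, ← qf_one]
          ring_nf
      _ = ∫⁻ v : Fin d → ℂ, ∫⁻ U,
            ENNReal.ofReal (Real.exp (-(qf 1 v - t * (qf 1 v * X U)))) ∂haarUnitary d := by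
          refine lintegral_lintegral_swap (Measurable.aemeasurable ?_)
          refine (Continuous.measurable ?_)
          have := hXc.comp (continuous_fst (X := Matrix.unitaryGroup (Fin d) ℂ)
            (Y := Fin d → ℂ))
          have h2 := (continuous_qf (1 : Matrix (Fin d) (Fin d) ℂ)).comp
            (continuous_snd (X := Matrix.unitaryGroup (Fin d) ℂ) (Y := Fin d → ℂ))
          refine ENNReal.continuous_ofReal.comp (Real.continuous_exp.comp ?_)
          exact (h2.sub (continuous_const.mul (h2.mul this))).neg
      _ = ∫⁻ v : Fin d → ℂ, ∫⁻ U, ENNReal.ofReal (Real.exp (-(qf 1 v -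
            t * qf S ((U : Matrix (Fin d) (Fin d) ℂ)ᴴ *ᵥ v)))) ∂haarUnitary d := by
          refine lintegral_congr fun v => ?_
          rw [lintegral_haarUnitary_mulVec S ψ hψ v
            fun x => ENNReal.ofReal (Real.exp (-(qf 1 v - t * x)))]
      _ = ∫⁻ U, (∫⁻ v : Fin d → ℂ, ENNReal.ofReal (Real.exp (-(qf 1 v -
            t * qf S ((U : Matrix (Fin d) (Fin d) ℂ)ᴴ *ᵥ v))))) ∂haarUnitary d := by
          refine (lintegral_lintegral_swap (Measurable.aemeasurable ?_)).symm
          refine (Continuous.measurable ?_)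
          have h2 := (continuous_qf (1 : Matrix (Fin d) (Fin d) ℂ)).comp
            (continuous_snd (X := Matrix.unitaryGroup (Fin d) ℂ) (Y := Fin d → ℂ))
          refine ENNReal.continuous_ofReal.comp (Real.continuous_exp.comp ?_)
          exact (h2.sub (continuous_const.mul hcont)).neg
      _ = ∫⁻ _U : Matrix.unitaryGroup (Fin d) ℂ, (∫⁻ v : Fin d → ℂ,
            ENNReal.ofReal (Real.exp (-(qf 1 v - t * qf S v)))) ∂haarUnitary d := by
          refine lintegral_congr fun U => ?_
          have hU := conjTranspose_mem_unitaryGroup U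
          have h := (measurePreserving_mulVec_unitary hU).lintegral_comp
            (f := fun v => ENNReal.ofReal (Real.exp (-(qf 1 v - t * qf S v)))) (by fun_prop)
          simp only [qf_one_unitary hU] at h
          exact h
      _ = _ := by simp
  have hle := key.trans_le (hS.lintegral_gaussian_le ht)
  have hpi : (0 : ℝ) < Real.pi ^ d := by positivity
  -- Pointwise `exp x ≤ 1 / (1 - x)` at `x = t X`, raised to the power `d`.
  have hlow : ENNReal.ofReal (Real.pi ^ d) *
      ∫⁻ U, ENNReal.ofReal (Real.exp (t * d * X U)) ∂haarUnitary d ≤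
      ∫⁻ U, ENNReal.ofReal ((Real.pi / (1 - t * X U)) ^ d) ∂haarUnitary d := by
    rw [← lintegral_const_mul' _ _ ENNReal.ofReal_ne_top]
    refine lintegral_mono fun U => ?_
    rw [← ENNReal.ofReal_mul hpi.le]
    refine ENNReal.ofReal_le_ofReal ?_
    have hpos : 0 < 1 - t * X U := by linarith [hX1 U]
    rw [div_eq_mul_inv, mul_pow]
    refine mul_le_mul_of_nonneg_left ?_ hpi.le
    rw [show t * d * X U = d * (t * X U) by ring, Real.exp_nat_mul]
    refine pow_le_pow_left₀ (Real.exp_pos _).le ?_ d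
    rw [← neg_neg (t * X U), Real.exp_neg]
    refine inv_anti₀ (by linarith) ?_
    have := Real.add_one_le_exp (-(t * X U))
    linarith
  have h := hlow.trans hle
  rw [ENNReal.ofReal_mul hpi.le] at h
  exact (ENNReal.mul_le_mul_iff_right (by simpa using hpi) ENNReal.ofReal_ne_top).1 h

/-- From `exp |x| ≤ exp x + exp (-x)`, with the preceding bound at `t` and `-t`. -/
theorem integral_exp_abs_qf_le (hS : IsTracelessContraction S) {t : ℝ} (ht : |t| ≤ 1 / 2)
    (ψ : Fin d → ℂ) (hψ : qf 1 ψ = 1) :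
    ∫ U, Real.exp (t * d * |qf S ((U : Matrix (Fin d) (Fin d) ℂ)ᴴ *ᵥ ψ)|) ∂haarUnitary d ≤
      2 * Real.exp (2 * t ^ 2 * d) := by
  have hc := continuous_qf_conjTranspose_mulVec_left S ψ
  rw [integral_eq_lintegral_of_nonneg_ae (Filter.Eventually.of_forall fun _ => (Real.exp_pos _).le)
    (Continuous.aestronglyMeasurable (by fun_prop))]
  refine ENNReal.toReal_le_of_le_ofReal (by positivity) ?_
  have h1 := hS.lintegral_exp_qf_le ht ψ hψ
  have h2 := hS.lintegral_exp_qf_le (t := -t) (by rwa [abs_neg]) ψ hψ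
  rw [two_mul (Real.exp _), ENNReal.ofReal_add (Real.exp_pos _).le (Real.exp_pos _).le]
  rw [neg_sq] at h2
  refine le_trans ?_ (add_le_add h1 h2)
  rw [← lintegral_add_left (Measurable.ennreal_ofReal
    (Continuous.measurable (by fun_prop)))]
  refine lintegral_mono fun U => ?_
  rcases abs_choice (qf S ((U : Matrix (Fin d) (Fin d) ℂ)ᴴ *ᵥ ψ)) with h | h
  · rw [h]
    exact le_self_add
  · rw [h, mul_neg, neg_mul, neg_mul]
    exact le_add_self

/-- Exponential concentration of `∑ i, |⟨ψ|U_i S U_i†|ψ⟩|` for independent Haar unitaries `U_i`. -/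
theorem measureReal_sum_abs_qf_ge_le (hS : IsTracelessContraction S) (hd : 0 < d)
    {Ω : Type*} [MeasurableSpace Ω] {P : Measure Ω} [IsProbabilityMeasure P]
    {U : Fin d → Ω → Matrix.unitaryGroup (Fin d) ℂ}
    (hU : ∀ i, HasLaw (U i) (haarUnitary d) P) (hind : iIndepFun U P)
    (ψ : Fin d → ℂ) (hψ : qf 1 ψ = 1) :
    P.real {ω | 12 * √d ≤ ∑ i, |qf S ((U i ω : Matrix (Fin d) (Fin d) ℂ)ᴴ *ᵥ ψ)|} ≤
      (2 * Real.exp (-(11 / 2))) ^ d := by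
  have hd' : (1 : ℝ) ≤ d := by exact_mod_cast hd
  have hsq : √(d : ℝ) * √d = d := Real.mul_self_sqrt (by positivity)
  have hs1 : 1 ≤ √(d : ℝ) := Real.one_le_sqrt.2 hd'
  have hspos : 0 < √(d : ℝ) := by linarith
  have hc := continuous_qf_conjTranspose_mulVec_left S ψ
  set f : Matrix.unitaryGroup (Fin d) ℂ → ℝ := fun V =>
    |qf S ((V : Matrix (Fin d) (Fin d) ℂ)ᴴ *ᵥ ψ)| with hf
  have hfc : Continuous f := hc.abs
  have hf1 : ∀ V, f V ≤ 1 := fun V => (hS.abs_qf_conjTranspose_mulVec_le V ψ).trans_eq hψ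
  have hmeas : ∀ i, AEMeasurable (U i) P := fun i => (hU i).aemeasurable
  have hint : Integrable (fun ω => Real.exp (√d / 2 * ∑ i, f (U i ω))) P := by
    refine Integrable.of_bound (C := Real.exp (√d / 2 * d)) ?_ (Filter.Eventually.of_forall fun ω => ?_)
    · refine AEMeasurable.aestronglyMeasurable ?_
      refine Real.measurable_exp.comp_aemeasurable (AEMeasurable.const_mul ?_ _)
      exact Finset.aemeasurable_fun_sum _ fun i _ => hfc.measurable.comp_aemeasurable (hmeas i)
    · rw [Real.norm_of_nonneg (Real.exp_pos _).le]
      refine Real.exp_le_exp.2 (mul_le_mul_of_nonneg_left ?_ (by positivity))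
      calc ∑ i, f (U i ω) ≤ ∑ _i : Fin d, (1 : ℝ) := Finset.sum_le_sum fun i _ => hf1 _
        _ = d := by simp
  have hmgf : mgf (fun ω => ∑ i, f (U i ω)) P (√d / 2) ≤ (2 * Real.exp (1 / 2)) ^ d := by
    have h1 : ∀ ω, Real.exp (√d / 2 * ∑ i, f (U i ω)) = ∏ i, Real.exp (√d / 2 * f (U i ω)) :=
      fun ω => by rw [Finset.mul_sum, Real.exp_sum]
    simp only [mgf, h1]
    rw [hind.integral_fun_prod_comp (f := fun _ V => Real.exp (√d / 2 * f V)) hmeas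
      fun i => Continuous.aestronglyMeasurable (by fun_prop)]
    have h2 : ∀ i, ∫ ω, Real.exp (√d / 2 * f (U i ω)) ∂P ≤ 2 * Real.exp (1 / 2) := fun i => by
      rw [← integral_map (f := fun V => Real.exp (√d / 2 * f V)) (hmeas i)
        (Continuous.aestronglyMeasurable (by fun_prop)), (hU i).map_eq]
      -- With this `t` the Chernoff parameter is `t d = √d / 2` and the variance term `2 t² d` is
      -- the constant `1/2`.
      have h3 := hS.integral_exp_abs_qf_le (t := 1 / (2 * √d)) (by
        rw [abs_of_nonneg (by positivity)]
        exact one_div_le_one_div_of_le (by norm_num) (by linarith)) ψ hψ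
      have h4 : 1 / (2 * √d) * (d : ℝ) = √d / 2 := by
        rw [one_div_mul_eq_div, div_eq_div_iff (by positivity) (by norm_num)]
        linear_combination -2 * hsq
      have h5 : 2 * (1 / (2 * √d)) ^ 2 * (d : ℝ) = 1 / 2 := by
        rw [div_pow, mul_pow, Real.sq_sqrt (by positivity)]; field_simp
      rw [h4, h5] at h3
      exact h3
    calc _ ≤ ∏ _i : Fin d, 2 * Real.exp (1 / 2) :=
          Finset.prod_le_prod (fun i _ => integral_nonneg fun ω => (Real.exp_pos _).le)
            fun i _ => h2 i
      _ = _ := by simp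
  refine (measure_ge_le_exp_mul_mgf _ (by positivity) hint).trans ?_
  refine (mul_le_mul_of_nonneg_left hmgf (Real.exp_pos _).le).trans_eq ?_
  -- The threshold contributes `-6` per factor and the moment `1/2`, which together make `-11/2`.
  have h6 : -(√(d : ℝ) / 2) * (12 * √d) = d * (-6) := by linear_combination -6 * hsq
  rw [h6, Real.exp_nat_mul, ← mul_pow]
  congr 1
  rw [mul_left_comm, ← Real.exp_add]
  norm_num

end IsTracelessContraction

/-! ### Nets on the unit sphere -/

/-- A `1/2`-net of the unit sphere of `ℂ^d` with at most `25 ^ d` points. -/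
theorem exists_net (d : ℕ) : ∃ N : Finset (Fin d → ℂ), N.card ≤ 25 ^ d ∧ (∀ φ ∈ N, qf 1 φ = 1) ∧
    ∀ ψ : Fin d → ℂ, qf 1 ψ = 1 → ∃ φ ∈ N, qf 1 (ψ - φ) ≤ 1 / 4 := by
  classical
  let E := EuclideanSpace ℂ (Fin d)
  let sep : Finset E → Prop := fun s => (∀ c ∈ s, ‖c‖ = 2) ∧ ∀ c ∈ s, ∀ e ∈ s, c ≠ e → 1 ≤ ‖c - e‖
  have hcard : ∀ s, sep s → s.card ≤ 25 ^ d := fun s hs => by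
    -- A 1-separated set in the ball of radius 2 has at most `5^(2d)` points, as `2d` is the real
    -- dimension. A separated set of maximal size is a net, and halving it lands on the unit sphere.
    have := Besicovitch.card_le_of_separated s (fun c hc => (hs.1 c hc).le) hs.2
    rw [finrank_real_of_complex, finrank_euclideanSpace_fin, pow_mul] at this
    exact this
  let T : Set ℕ := {k | ∃ s, sep s ∧ s.card = k}
  have hT : T.Nonempty := ⟨0, ∅, ⟨by simp, by simp⟩, rfl⟩
  have hTb : BddAbove T := ⟨25 ^ d, by rintro _ ⟨s, hs, rfl⟩; exact hcard s hs⟩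
  obtain ⟨s, hs, hsc⟩ := Nat.sSup_mem hT hTb
  refine ⟨s.image fun c => (1 / 2 : ℂ) • c.ofLp, Finset.card_image_le.trans (hcard s hs), ?_, ?_⟩
  · intro φ hφ
    obtain ⟨c, hc, rfl⟩ := Finset.mem_image.1 hφ
    rw [qf_smul, ← norm_sq_toLp, WithLp.toLp_ofLp, hs.1 c hc]
    norm_num
  · intro ψ hψ
    have hψn : ‖WithLp.toLp 2 ψ‖ = 1 := by
      have := norm_sq_toLp ψ
      rw [hψ] at this
      exact (pow_eq_one_iff_of_nonneg (norm_nonneg _) two_ne_zero).1 this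
    set e : E := (2 : ℂ) • WithLp.toLp 2 ψ with he
    have hen : ‖e‖ = 2 := by rw [he, norm_smul, hψn]; norm_num
    have hex : ∃ c ∈ s, ‖e - c‖ < 1 := by
      by_contra! hcon
      have hes : e ∉ s := fun h => by
        have := hcon e h
        simp at this
        linarith
      have hsep : sep (insert e s) := by
        refine ⟨fun c hc => ?_, fun c hc c' hc' hne => ?_⟩
        · rcases Finset.mem_insert.1 hc with rfl | hc
          exacts [hen, hs.1 c hc]
        · rcases Finset.mem_insert.1 hc with rfl | hc <;> rcases Finset.mem_insert.1 hc' with rfl | hc'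
          · exact (hne rfl).elim
          · exact hcon _ hc'
          · rw [norm_sub_rev]; exact hcon _ hc
          · exact hs.2 _ hc _ hc' hne
      have := le_csSup hTb ⟨_, hsep, rfl⟩
      rw [Finset.card_insert_of_notMem hes, ← hsc] at this
      omega
    obtain ⟨c, hc, hlt⟩ := hex
    refine ⟨_, Finset.mem_image_of_mem _ hc, ?_⟩
    have h1 : ψ - (1 / 2 : ℂ) • c.ofLp = (1 / 2 : ℂ) • (e - c).ofLp := by
      ext j
      change ψ j - 1 / 2 * c.ofLp j = 1 / 2 * (2 * ψ j - c.ofLp j)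
      ring
    rw [h1, qf_smul, ← norm_sq_toLp, WithLp.toLp_ofLp]
    norm_num
    nlinarith [norm_nonneg (e - c)]

/-- Polarization: the two vectors are `(x + y)/2 ± 2 (x - y)`. The weight 2 on the small difference
`x - y` nearly balances the two parts when `‖x - y‖ = 1/2`. -/
theorem qf_sub_qf {n : Type} [Fintype n] (A : Matrix n n ℂ) (x y : n → ℂ) :
    4 * (qf A x - qf A y) =
      qf A ((5 / 2 : ℂ) • x - (3 / 2 : ℂ) • y) - qf A ((5 / 2 : ℂ) • y - (3 / 2 : ℂ) • x) := by
  have h5 : star (5 / 2 : ℂ) = 5 / 2 := by simp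
  have h3 : star (3 / 2 : ℂ) = 3 / 2 := by simp
  simp only [qf]
  rw [← Complex.sub_re, ← Complex.sub_re, ← Complex.re_ofReal_mul]
  congr 1
  simp only [star_sub, star_smul, Matrix.mulVec_sub, Matrix.mulVec_smul, sub_dotProduct,
    dotProduct_sub, smul_dotProduct, dotProduct_smul, h5, h3, smul_eq_mul]
  push_cast
  ring

/-- For unit vectors with `‖x - y‖² ≤ 1/4` the value is at most `31/16`, below the 2 at which the
net argument would fail. -/
theorem qf_one_combination {n : Type} [Fintype n] [DecidableEq n] (x y : n → ℂ) :
    qf 1 ((5 / 2 : ℂ) • x - (3 / 2 : ℂ) • y) =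
      15 / 4 * qf 1 (x - y) + 5 / 2 * qf 1 x - 3 / 2 * qf 1 y := by
  have h5 : star (5 / 2 : ℂ) = 5 / 2 := by simp
  have h3 : star (3 / 2 : ℂ) = 3 / 2 := by simp
  have h (r : ℝ) (z : ℂ) : r * z.re = (r * z).re := (Complex.re_ofReal_mul r z).symm
  simp only [qf, h]
  rw [← Complex.add_re, ← Complex.sub_re]
  congr 1
  simp only [star_sub, star_smul, Matrix.mulVec_sub, Matrix.mulVec_smul, sub_dotProduct,
    dotProduct_sub, smul_dotProduct, dotProduct_smul, h5, h3, smul_eq_mul]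
  push_cast
  ring

/-- A bound on a net controls a sum of absolute values of quadratic forms everywhere. -/
theorem sum_abs_qf_le_of_net {d : ℕ} {ι : Type} [Fintype ι] {A : ι → Matrix (Fin d) (Fin d) ℂ}
    {N : Finset (Fin d → ℂ)}
    (hN : ∀ ψ : Fin d → ℂ, qf 1 ψ = 1 → ∃ φ ∈ N, qf 1 (ψ - φ) ≤ 1 / 4)
    (hN1 : ∀ φ ∈ N, qf 1 φ = 1) (hA : ∀ i v, |qf (A i) v| ≤ qf 1 v) {K : ℝ}
    (hK : ∀ φ ∈ N, ∑ i, |qf (A i) φ| ≤ K) (v : Fin d → ℂ) :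
    ∑ i, |qf (A i) v| ≤ 32 * K * qf 1 v := by
  set F : (Fin d → ℂ) → ℝ := fun v => ∑ i, |qf (A i) v| with hF
  have hFsmul : ∀ (c : ℂ) v, F (c • v) = ‖c‖ ^ 2 * F v := fun c v => by
    simp only [hF, qf_smul, abs_mul, abs_of_nonneg (sq_nonneg ‖c‖), Finset.mul_sum]
  rcases (qf_one_nonneg v).eq_or_lt with h0 | h0
  · rw [← h0, mul_zero]
    refine Finset.sum_nonpos fun i _ => ?_
    rw [h0]
    exact hA i v
  set T : Set ℝ := F '' {ψ | qf 1 ψ = 1} with hT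
  have hTb : BddAbove T := by
    refine ⟨Fintype.card ι, ?_⟩
    rintro _ ⟨ψ, hψ, rfl⟩
    calc F ψ ≤ ∑ _i : ι, (1 : ℝ) := Finset.sum_le_sum fun i _ => (hA i ψ).trans_eq hψ
      _ = _ := by simp
  have hscale : ∀ w, 0 < qf 1 w → ((√(qf 1 w) : ℂ)⁻¹ • w ∈ {ψ : Fin d → ℂ | qf 1 ψ = 1}) ∧
      F w = F ((√(qf 1 w) : ℂ)⁻¹ • w) * qf 1 w := fun w hw => by
    have hn : ‖(√(qf 1 w) : ℂ)⁻¹‖ ^ 2 = (qf 1 w)⁻¹ := by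
      rw [norm_inv, Complex.norm_real, Real.norm_of_nonneg (Real.sqrt_nonneg _), inv_pow,
        Real.sq_sqrt hw.le]
    refine ⟨?_, ?_⟩
    · rw [Set.mem_ofPred_eq, qf_smul, hn, inv_mul_cancel₀ hw.ne']
    · rw [hFsmul, hn]; field_simp
  have hhom : ∀ w, F w ≤ sSup T * qf 1 w := fun w => by
    rcases (qf_one_nonneg w).eq_or_lt with hw | hw
    · rw [← hw, mul_zero]
      refine Finset.sum_nonpos fun i _ => ?_
      rw [hw]
      exact hA i w
    · obtain ⟨h1, h2⟩ := hscale w hw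
      rw [h2]
      exact mul_le_mul_of_nonneg_right (le_csSup hTb ⟨_, h1, rfl⟩) hw.le
  have hTne : T.Nonempty := ⟨_, _, (hscale v h0).1, rfl⟩
  have hT0 : 0 ≤ sSup T := Real.sSup_nonneg (by
    rintro _ ⟨ψ, -, rfl⟩
    exact Finset.sum_nonneg fun i _ => abs_nonneg _)
  -- By polarization, moving from `ψ` to a net point costs at most `(1/4) (31/16 + 31/16) = 31/32`
  -- of the supremum, which can be absorbed since the supremum is finite.
  have hstep : sSup T ≤ K + 31 / 32 * sSup T := by
    refine csSup_le hTne ?_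
    rintro _ ⟨ψ, hψ, rfl⟩
    obtain ⟨φ, hφ, hφψ⟩ := hN ψ hψ
    have hψ1 : qf 1 ψ = 1 := hψ
    have hφ1 := hN1 φ hφ
    have h1 : F ψ ≤ F φ + (1 / 4) * (F ((5 / 2 : ℂ) • ψ - (3 / 2 : ℂ) • φ) +
        F ((5 / 2 : ℂ) • φ - (3 / 2 : ℂ) • ψ)) := by
      simp only [hF]
      rw [← Finset.sum_add_distrib, Finset.mul_sum, ← Finset.sum_add_distrib]
      refine Finset.sum_le_sum fun i _ => ?_
      have h := qf_sub_qf (A i) ψ φ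
      set p := qf (A i) ((5 / 2 : ℂ) • ψ - (3 / 2 : ℂ) • φ)
      set q := qf (A i) ((5 / 2 : ℂ) • φ - (3 / 2 : ℂ) • ψ)
      have h2 : qf (A i) ψ = qf (A i) φ + 1 / 4 * (p - q) := by linarith
      rw [h2]
      refine (abs_add_le _ _).trans ?_
      rw [abs_mul, abs_of_pos (by norm_num : (0 : ℝ) < 1 / 4)]
      linarith [abs_sub p q]
    have h2 := hhom ((5 / 2 : ℂ) • ψ - (3 / 2 : ℂ) • φ)
    have h3 := hhom ((5 / 2 : ℂ) • φ - (3 / 2 : ℂ) • ψ)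
    rw [qf_one_combination, hψ1, hφ1] at h2 h3
    have h4 : qf 1 (φ - ψ) = qf 1 (ψ - φ) := by
      rw [← neg_sub ψ φ, ← neg_one_smul ℂ, qf_smul]
      simp
    rw [h4] at h3
    have h5 := mul_le_mul_of_nonneg_left hφψ hT0
    linarith [hK φ hφ]
  have hfin : sSup T ≤ 32 * K := by linarith
  exact (hhom v).trans (mul_le_mul_of_nonneg_right hfin h0.le)

end
-- Positive operators and measurement statistics
noncomputable section

section Positive

variable {n : Type} [Fintype n]

/-- `Q† Q` is the sum of the rank-one operators of the conjugated rows of `Q`. -/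
theorem trace_conjTranspose_mul_self_mul (Q A : Matrix n n ℂ) :
    (Qᴴ * Q * A).trace = ∑ k, star (star (Q k)) ⬝ᵥ A *ᵥ star (Q k) := by
  rw [mul_assoc, Matrix.trace_mul_comm, Matrix.trace]
  refine Finset.sum_congr rfl fun k _ => ?_
  rw [star_star, Matrix.dotProduct_mulVec]
  rfl

theorem IsStarProjection.posSemidef {p : Matrix n n ℂ} (hp : IsStarProjection p) :
    p.PosSemidef := by
  have h := Matrix.posSemidef_conjTranspose_mul_self p
  rwa [← Matrix.star_eq_conjTranspose, hp.isSelfAdjoint.star_eq, hp.isIdempotentElem.eq] at h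

theorem qf_ofReal_smul (c : ℝ) (S : Matrix n n ℂ) (v : n → ℂ) :
    qf ((c : ℂ) • S) v = c * qf S v := by
  rw [qf, Matrix.smul_mulVec, dotProduct_smul, smul_eq_mul, Complex.re_ofReal_mul, qf]

variable [DecidableEq n]

open scoped MatrixOrder in
theorem Matrix.PosSemidef.exists_eq_conjTranspose_mul_self {A : Matrix n n ℂ}
    (hA : A.PosSemidef) : ∃ Q : Matrix n n ℂ, A = Qᴴ * Q :=
  CStarAlgebra.nonneg_iff_eq_star_mul_self.mp hA.nonneg

theorem Matrix.PosSemidef.trace_mul_eq_norm {A B : Matrix n n ℂ} (hA : A.PosSemidef)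
    (hB : B.PosSemidef) : (A * B).trace = (‖(A * B).trace‖ : ℂ) := by
  obtain ⟨Q, rfl⟩ := hA.exists_eq_conjTranspose_mul_self
  have h : 0 ≤ (Qᴴ * Q * B).trace := by
    rw [trace_conjTranspose_mul_self_mul]
    exact Finset.sum_nonneg fun k _ => hB.dotProduct_mulVec_nonneg _
  exact (Complex.norm_of_nonneg' h).symm

theorem Matrix.PosSemidef.norm_trace_mul {A B : Matrix n n ℂ} (hA : A.PosSemidef)
    (hB : B.PosSemidef) : ‖(A * B).trace‖ = (A * B).trace.re := by
  conv_rhs => rw [hA.trace_mul_eq_norm hB, Complex.ofReal_re]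

/-- A bound on `∑ i, |⟨v|A_i|v⟩|` for unit vectors bounds `∑ i, |tr (N A_i)|` for positive `N`. -/
theorem sum_norm_trace_mul_le {ι : Type} [Fintype ι] {A : ι → Matrix n n ℂ}
    (hA : ∀ i, (A i).IsHermitian) {B : ℝ} (hB : ∀ v, ∑ i, |qf (A i) v| ≤ B * qf 1 v)
    {N : Matrix n n ℂ} (hN : N.PosSemidef) :
    ∑ i, ‖(N * A i).trace‖ ≤ B * N.trace.re := by
  obtain ⟨Q, rfl⟩ := hN.exists_eq_conjTranspose_mul_self
  have htr : (Qᴴ * Q).trace.re = ∑ k, qf 1 (star (Q k)) := by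
    have := trace_conjTranspose_mul_self_mul Q 1
    rw [mul_one] at this
    rw [this, Complex.re_sum]
    rfl
  have hnorm : ∀ i v, ‖star v ⬝ᵥ A i *ᵥ v‖ = |qf (A i) v| := fun i v => by
    have him : (star v ⬝ᵥ A i *ᵥ v).im = 0 := (hA i).im_star_dotProduct_mulVec_self v
    rw [qf, Complex.abs_re_eq_norm.2 him]
  calc ∑ i, ‖(Qᴴ * Q * A i).trace‖ ≤ ∑ i, ∑ k, |qf (A i) (star (Q k))| := by
        refine Finset.sum_le_sum fun i _ => ?_
        rw [trace_conjTranspose_mul_self_mul]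
        refine (norm_sum_le _ _).trans_eq (Finset.sum_congr rfl fun k _ => hnorm i _)
    _ = ∑ k, ∑ i, |qf (A i) (star (Q k))| := Finset.sum_comm
    _ ≤ ∑ k, B * qf 1 (star (Q k)) := Finset.sum_le_sum fun k _ => hB _
    _ = _ := by rw [htr, Finset.mul_sum]

theorem POVM.sum_norm_trace_mul (M : POVM n) {ρ : Matrix n n ℂ} (hρ : IsState ρ) :
    ∑ i, ‖(M.effect i * ρ).trace‖ = 1 := by
  have h : ∀ i, ‖(M.effect i * ρ).trace‖ = (M.effect i * ρ).trace.re := fun i =>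
    (M.posSemidef i).norm_trace_mul hρ.1
  simp only [h]
  rw [← Complex.re_sum, ← Matrix.trace_sum, ← Finset.sum_mul, M.sum_eq_one, one_mul, hρ.2,
    Complex.one_re]

theorem POVM.seminorm_sub_le_two (M : POVM n) {ρ σ : Matrix n n ℂ} (hρ : IsState ρ)
    (hσ : IsState σ) : M.seminorm (ρ - σ) ≤ 2 := by
  calc M.seminorm (ρ - σ) ≤ ∑ i, (‖(M.effect i * ρ).trace‖ + ‖(M.effect i * σ).trace‖) := by
        refine Finset.sum_le_sum fun i _ => ?_
        rw [mul_sub, Matrix.trace_sub]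
        exact norm_sub_le _ _
    _ = 2 := by
        rw [Finset.sum_add_distrib, M.sum_norm_trace_mul hρ, M.sum_norm_trace_mul hσ]
        norm_num

theorem IsStarProjection.qf_mem_Icc {p : Matrix n n ℂ} (hp : IsStarProjection p) (v : n → ℂ) :
    0 ≤ qf p v ∧ qf p v ≤ qf 1 v := by
  have h : ∀ {r : Matrix n n ℂ}, IsStarProjection r → 0 ≤ qf r v := fun {r} hr =>
    (Complex.le_def.1 (hr.posSemidef.dotProduct_mulVec_nonneg v)).1
  refine ⟨h hp, ?_⟩
  have := h hp.one_sub
  rw [qf_sub] at this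
  linarith

end Positive

/-! ### Basis and projective measurements -/

section Ketbra

variable {d : ℕ} (b : OrthonormalBasis (Fin d) ℂ (EuclideanSpace ℂ (Fin d)))

theorem posSemidef_ketbra (v : EuclideanSpace ℂ (Fin d)) : (ketbra v).PosSemidef :=
  Matrix.posSemidef_vecMulVec_self_star _

theorem trace_ketbra_mul_ketbra (i j : Fin d) :
    (ketbra (b i) * ketbra (b j)).trace = if i = j then 1 else 0 := by
  have h : ∀ i j, star (b i).ofLp ⬝ᵥ (b j).ofLp = if i = j then 1 else 0 := fun i j => by
    rw [← orthonormal_iff_ite.1 b.orthonormal i j, EuclideanSpace.inner_eq_star_dotProduct,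
      dotProduct_comm]
  rw [ketbra, ketbra, Matrix.vecMulVec_mul_vecMulVec, Matrix.trace_vecMulVec,
    dotProduct_smul, h, dotProduct_comm, h]
  rcases eq_or_ne i j with rfl | hij
  · simp
  · simp [hij]

theorem isState_ketbra (i : Fin d) : IsState (ketbra (b i)) := by
  refine ⟨posSemidef_ketbra _, ?_⟩
  rw [ketbra, Matrix.trace_vecMulVec, dotProduct_comm]
  have := orthonormal_iff_ite.1 b.orthonormal i i
  rw [EuclideanSpace.inner_eq_star_dotProduct, dotProduct_comm, if_pos rfl] at this
  exact this

theorem sum_ketbra : ∑ i, ketbra (b i) = 1 := by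
  have h1 : (EuclideanSpace.basisFun (Fin d) ℂ).toBasis.toMatrix b.toBasis ∈
      Matrix.unitaryGroup (Fin d) ℂ :=
    (EuclideanSpace.basisFun (Fin d) ℂ).toMatrix_orthonormalBasis_mem_unitary b
  rw [← Matrix.mem_unitaryGroup_iff.1 h1]
  ext x y
  simp [Matrix.sum_apply, ketbra, Matrix.vecMulVec_apply, Matrix.mul_apply,
    Module.Basis.toMatrix_apply]

/-- The measurement in an orthonormal basis. -/
def POVM.ofBasis : POVM (Fin d) where
  outcome := Fin d
  effect i := ketbra (b i)
  posSemidef _ := posSemidef_ketbra _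
  sum_eq_one := sum_ketbra b

/-- The two-outcome measurement `{p, 1 - p}` of a projection. -/
def POVM.ofProjection {n : Type} [Fintype n] [DecidableEq n] {p : Matrix n n ℂ}
    (hp : IsStarProjection p) : POVM n where
  outcome := Bool
  effect x := if x then p else 1 - p
  posSemidef x := by
    cases x
    · simpa using hp.one_sub.posSemidef
    · simpa using hp.posSemidef
  sum_eq_one := by simp

end Ketbra

/-! ### Ensembles of rotated operators and their distinguishability -/

section Ensemble

variable {d : ℕ}

theorem conj_trace (U : Matrix.unitaryGroup (Fin d) ℂ) (T : Matrix (Fin d) (Fin d) ℂ) :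
    ((U : Matrix (Fin d) (Fin d) ℂ) * T * (U : Matrix (Fin d) (Fin d) ℂ)ᴴ).trace = T.trace := by
  have h : (U : Matrix (Fin d) (Fin d) ℂ)ᴴ * U = 1 := Matrix.mem_unitaryGroup_iff'.1 U.2
  rw [Matrix.trace_mul_comm, ← mul_assoc, h, one_mul]

theorem conj_mul_conj (U : Matrix.unitaryGroup (Fin d) ℂ) (S T : Matrix (Fin d) (Fin d) ℂ) :
    ((U : Matrix (Fin d) (Fin d) ℂ) * S * (U : Matrix (Fin d) (Fin d) ℂ)ᴴ) *
      ((U : Matrix (Fin d) (Fin d) ℂ) * T * (U : Matrix (Fin d) (Fin d) ℂ)ᴴ) =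
      (U : Matrix (Fin d) (Fin d) ℂ) * (S * T) * (U : Matrix (Fin d) (Fin d) ℂ)ᴴ := by
  have h : (U : Matrix (Fin d) (Fin d) ℂ)ᴴ * U = 1 := Matrix.mem_unitaryGroup_iff'.1 U.2
  simp only [mul_assoc]
  rw [← mul_assoc (U : Matrix (Fin d) (Fin d) ℂ)ᴴ (U : Matrix (Fin d) (Fin d) ℂ), h, one_mul]

theorem IsStarProjection.conj {p : Matrix (Fin d) (Fin d) ℂ} (hp : IsStarProjection p)
    (U : Matrix.unitaryGroup (Fin d) ℂ) :
    IsStarProjection ((U : Matrix (Fin d) (Fin d) ℂ) * p * (U : Matrix (Fin d) (Fin d) ℂ)ᴴ) := by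
  refine ⟨?_, ?_⟩
  · rw [IsIdempotentElem, conj_mul_conj, hp.isIdempotentElem.eq]
  · have h : pᴴ = p := hp.isSelfAdjoint.star_eq
    rw [IsSelfAdjoint, Matrix.star_eq_conjTranspose, Matrix.conjTranspose_mul,
      Matrix.conjTranspose_mul, Matrix.conjTranspose_conjTranspose, h, mul_assoc]

/-- The operator `(1/d) ∑ i, |i⟩⟨i| ⊗ U_i T U_i†`. -/
def ensemble (b : OrthonormalBasis (Fin d) ℂ (EuclideanSpace ℂ (Fin d)))
    (T : Matrix (Fin d) (Fin d) ℂ) (U : Fin d → Matrix.unitaryGroup (Fin d) ℂ) :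
    Matrix (Fin d × Fin d) (Fin d × Fin d) ℂ :=
  (1 / (d : ℂ)) • ∑ i, ketbra (b i) ⊗ₖ
    ((U i : Matrix (Fin d) (Fin d) ℂ) * T * (U i : Matrix (Fin d) (Fin d) ℂ)ᴴ)

variable (b : OrthonormalBasis (Fin d) ℂ (EuclideanSpace ℂ (Fin d)))
  (U : Fin d → Matrix.unitaryGroup (Fin d) ℂ)

theorem ensemble_sub (S T : Matrix (Fin d) (Fin d) ℂ) :
    ensemble b S U - ensemble b T U = ensemble b (S - T) U := by
  rw [ensemble, ensemble, ensemble, ← smul_sub, ← Finset.sum_sub_distrib]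
  congr 1
  refine Finset.sum_congr rfl fun i _ => ?_
  rw [mul_sub, sub_mul]
  ext x y
  simp [mul_sub]

theorem trace_kronecker_mul_ensemble (M N T : Matrix (Fin d) (Fin d) ℂ) :
    ((M ⊗ₖ N) * ensemble b T U).trace = (1 / (d : ℂ)) * ∑ i, (M * ketbra (b i)).trace *
      (N * ((U i : Matrix (Fin d) (Fin d) ℂ) * T * (U i : Matrix (Fin d) (Fin d) ℂ)ᴴ)).trace := by
  rw [ensemble, Matrix.mul_smul, Matrix.trace_smul, Finset.mul_sum, Matrix.trace_sum, smul_eq_mul]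
  congr 1
  refine Finset.sum_congr rfl fun i _ => ?_
  rw [← Matrix.mul_kronecker_mul, Matrix.trace_kronecker]

theorem IsState.ensemble {T : Matrix (Fin d) (Fin d) ℂ} (hd : 0 < d) (hT : IsState T) :
    IsState (ensemble b T U) := by
  refine ⟨?_, ?_⟩
  · have hc : (0 : ℂ) ≤ 1 / (d : ℂ) := by
      rw [one_div]
      exact inv_nonneg.2 (Nat.cast_nonneg d)
    refine Matrix.PosSemidef.smul ?_ hc
    refine Matrix.posSemidef_sum _ fun i _ => ?_
    exact (posSemidef_ketbra _).kronecker (hT.1.mul_mul_conjTranspose_same _)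
  · have h := trace_kronecker_mul_ensemble b U 1 1 T
    have hd' : (d : ℂ) ≠ 0 := by exact_mod_cast hd.ne'
    simp only [Matrix.one_kronecker_one, one_mul, conj_trace, hT.2, (isState_ketbra b _).2] at h
    rw [h]
    simp [hd']

/-- The first party gains nothing over measuring in the basis `b`. -/
theorem distNorm_LO_ensemble_le {T : Matrix (Fin d) (Fin d) ℂ} (hd : 0 < d) (hT : T.IsHermitian)
    {B : ℝ}
    (hB : ∀ v, ∑ i, |qf T ((U i : Matrix (Fin d) (Fin d) ℂ)ᴴ *ᵥ v)| ≤ B * qf 1 v) :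
    distNorm (LO d) (ensemble b T U) ≤ B := by
  have hd' : (d : ℝ) ≠ 0 := by exact_mod_cast hd.ne'
  refine csSup_le ⟨_, _, ⟨POVM.ofBasis b, POVM.ofBasis b, rfl⟩, rfl⟩ ?_
  rintro _ ⟨_, ⟨M, N, rfl⟩, rfl⟩
  set A : Fin d → Matrix (Fin d) (Fin d) ℂ := fun i =>
    (U i : Matrix (Fin d) (Fin d) ℂ) * T * (U i : Matrix (Fin d) (Fin d) ℂ)ᴴ with hA
  have hAh : ∀ i, (A i).IsHermitian := fun i =>
    Matrix.isHermitian_mul_mul_conjTranspose _ hT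
  have hqA : ∀ v, ∑ i, |qf (A i) v| ≤ B * qf 1 v := fun v => by
    refine le_of_eq_of_le (Finset.sum_congr rfl fun i _ => ?_) (hB v)
    rw [qf_mulVec, Matrix.conjTranspose_conjTranspose]
  -- The effects of the second party have total trace `d`, which later cancels the weight `1/d`.
  have hN : ∑ l, ∑ i, ‖(N.effect l * A i).trace‖ ≤ B * d := by
    calc _ ≤ ∑ l, B * (N.effect l).trace.re :=
          Finset.sum_le_sum fun l _ => sum_norm_trace_mul_le hAh hqA (N.posSemidef l)
      _ = B * d := by
          rw [← Finset.mul_sum, ← Complex.re_sum, ← Matrix.trace_sum, N.sum_eq_one]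
          simp
  calc (M.tensor N).seminorm (ensemble b T U)
      = ∑ k, ∑ l, ‖((M.effect k ⊗ₖ N.effect l) * ensemble b T U).trace‖ :=
        Fintype.sum_prod_type _
    _ ≤ ∑ k, ∑ l, (1 / (d : ℝ)) * ∑ i, ‖(M.effect k * ketbra (b i)).trace‖ *
          ‖(N.effect l * A i).trace‖ := by
        refine Finset.sum_le_sum fun k _ => Finset.sum_le_sum fun l _ => ?_
        rw [trace_kronecker_mul_ensemble, norm_mul]
        refine mul_le_mul (by simp) ((norm_sum_le _ _).trans_eq ?_) (norm_nonneg _) (by positivity)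
        simp only [norm_mul, hA]
    _ = (1 / (d : ℝ)) * ∑ l, ∑ i, (∑ k, ‖(M.effect k * ketbra (b i)).trace‖) *
          ‖(N.effect l * A i).trace‖ := by
        rw [Finset.sum_comm]
        simp only [← Finset.mul_sum]
        congr 1
        refine Finset.sum_congr rfl fun l _ => ?_
        rw [Finset.sum_comm]
        simp only [← Finset.sum_mul]
    -- For each `i` the outcome probabilities of `M` on `|i⟩⟨i|` sum to one.
    _ = (1 / (d : ℝ)) * ∑ l, ∑ i, ‖(N.effect l * A i).trace‖ := by
        simp only [M.sum_norm_trace_mul (isState_ketbra b _), one_mul]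
    _ ≤ (1 / (d : ℝ)) * (B * d) := mul_le_mul_of_nonneg_left hN (by positivity)
    _ = B := by field_simp

/-- A pair of orthogonal projections of rank `m > 0` with orthogonal ranges. -/
structure IsProjectionPair (m : ℕ) (p q : Matrix (Fin d) (Fin d) ℂ) : Prop where
  pos : 0 < m
  left : IsStarProjection p
  right : IsStarProjection q
  mul_eq_zero : p * q = 0
  trace_left : p.trace = m
  trace_right : q.trace = m

namespace IsProjectionPair

variable {m : ℕ} {p q : Matrix (Fin d) (Fin d) ℂ}

theorem isState_smul {p : Matrix (Fin d) (Fin d) ℂ} (hm : 0 < m) (hp : IsStarProjection p)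
    (ht : p.trace = m) : IsState ((1 / (m : ℂ)) • p) := by
  have hm' : (m : ℂ) ≠ 0 := by exact_mod_cast hm.ne'
  refine ⟨hp.posSemidef.smul ?_, ?_⟩
  · rw [one_div]
    exact inv_nonneg.2 (Nat.cast_nonneg m)
  · rw [Matrix.trace_smul, ht, smul_eq_mul, one_div_mul_cancel hm']

theorem isState_left (h : IsProjectionPair m p q) (hd : 0 < d) :
    IsState (ensemble b ((1 / (m : ℂ)) • p) U) :=
  (isState_smul h.pos h.left h.trace_left).ensemble b U hd

theorem isState_right (h : IsProjectionPair m p q) (hd : 0 < d) :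
    IsState (ensemble b ((1 / (m : ℂ)) • q) U) :=
  (isState_smul h.pos h.right h.trace_right).ensemble b U hd

theorem isTracelessContraction_sub (h : IsProjectionPair m p q) :
    IsTracelessContraction (p - q) where
  isHermitian := h.left.isSelfAdjoint.sub h.right.isSelfAdjoint
  trace_eq_zero := by rw [Matrix.trace_sub, h.trace_left, h.trace_right, sub_self]
  abs_qf_le v := by
    have h1 := h.left.qf_mem_Icc v
    have h2 := h.right.qf_mem_Icc v
    rw [qf_sub, abs_le]
    constructor <;> linarith [h1.1, h1.2, h2.1, h2.2]

/-- The value 2 is attained by measuring in the basis `b` and then, on outcome `i`, testing the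
rotated projection `U_i p U_i†`. -/
theorem distNorm_LOCCOneWay (h : IsProjectionPair m p q) (hd : 0 < d) :
    distNorm (LOCCOneWay d)
      (ensemble b ((1 / (m : ℂ)) • p) U - ensemble b ((1 / (m : ℂ)) • q) U) = 2 := by
  have hm' : (m : ℂ) ≠ 0 := by exact_mod_cast h.pos.ne'
  have hd' : (d : ℝ) ≠ 0 := by exact_mod_cast hd.ne'
  let M : POVM (Fin d) := POVM.ofBasis b
  let N : M.outcome → POVM (Fin d) := fun i => POVM.ofProjection (h.left.conj (U i))
  have hmem : M.oneWay N ∈ LOCCOneWay d := ⟨M, N, rfl⟩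
  refine le_antisymm (csSup_le ⟨_, _, hmem, rfl⟩ ?_) ?_
  · rintro _ ⟨T, -, rfl⟩
    exact T.seminorm_sub_le_two (h.isState_left b U hd) (h.isState_right b U hd)
  · refine le_trans (le_of_eq ?_) (le_csSup (bddAbove_seminorm _ _) ⟨_, hmem, rfl⟩)
    rw [ensemble_sub, ← smul_sub]
    -- Each of the `2d` outcomes contributes `±1/d`, so the absolute values add up to 2.
    have hterm : ∀ (i : Fin d) (x : Bool),
        ((M.effect i ⊗ₖ (N i).effect x) * ensemble b ((1 / (m : ℂ)) • (p - q)) U).trace =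
          (1 / (d : ℂ)) * if x then 1 else -1 := fun i x => by
      have hp : ((U i : Matrix (Fin d) (Fin d) ℂ) * p * (U i : Matrix (Fin d) (Fin d) ℂ)ᴴ *
          ((U i : Matrix (Fin d) (Fin d) ℂ) * ((1 / (m : ℂ)) • (p - q)) *
            (U i : Matrix (Fin d) (Fin d) ℂ)ᴴ)).trace = 1 := by
        rw [conj_mul_conj, conj_trace, Matrix.mul_smul, mul_sub, h.left.isIdempotentElem.eq,
          h.mul_eq_zero, sub_zero, Matrix.trace_smul, h.trace_left, smul_eq_mul,
          one_div_mul_cancel hm']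
      rw [trace_kronecker_mul_ensemble, Finset.sum_eq_single i]
      · change 1 / (d : ℂ) * ((ketbra (b i) * ketbra (b i)).trace *
          ((if x then _ else 1 - _) * _ : Matrix (Fin d) (Fin d) ℂ).trace) = _
        rw [trace_ketbra_mul_ketbra, if_pos rfl, one_mul]
        cases x
        · simp only [Bool.false_eq_true, if_false]
          rw [sub_mul, Matrix.trace_sub, hp, one_mul, conj_trace, Matrix.trace_smul,
            Matrix.trace_sub, h.trace_left, h.trace_right, sub_self, smul_zero, zero_sub]
        · simp only [if_true]
          rw [hp]
      · intro j _ hj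
        change (ketbra (b i) * ketbra (b j)).trace * _ = 0
        rw [trace_ketbra_mul_ketbra, if_neg hj.symm, zero_mul]
      · simp
    have hsum : (M.oneWay N).seminorm (ensemble b ((1 / (m : ℂ)) • (p - q)) U) =
        ∑ i : Fin d, ∑ x : Bool,
          ‖((M.effect i ⊗ₖ (N i).effect x) * ensemble b ((1 / (m : ℂ)) • (p - q)) U).trace‖ :=
      Fintype.sum_sigma _
    refine Eq.trans ?_ hsum.symm
    simp only [hterm]
    simp
    field_simp
    norm_num

theorem distNorm_LO_le_of_net (h : IsProjectionPair m p q) (hd : 0 < d) (hdm : d ≤ 3 * m)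
    {N : Finset (Fin d → ℂ)}
    (hN : ∀ ψ : Fin d → ℂ, qf 1 ψ = 1 → ∃ φ ∈ N, qf 1 (ψ - φ) ≤ 1 / 4)
    (hN1 : ∀ φ ∈ N, qf 1 φ = 1)
    (hK : ∀ φ ∈ N, ∑ i, |qf (p - q) ((U i : Matrix (Fin d) (Fin d) ℂ)ᴴ *ᵥ φ)| ≤ 12 * √d) :
    distNorm (LO d) (ensemble b ((1 / (m : ℂ)) • p) U - ensemble b ((1 / (m : ℂ)) • q) U) ≤
      1152 / √(d : ℝ) := by
  have hS := h.isTracelessContraction_sub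
  have hm0 : (0 : ℝ) < m := by exact_mod_cast h.pos
  have hd0 : (0 : ℝ) < d := by exact_mod_cast hd
  have hspos : 0 < √(d : ℝ) := Real.sqrt_pos.2 hd0
  have hcast : (1 / (m : ℂ)) = ((1 / (m : ℝ) : ℝ) : ℂ) := by push_cast; rfl
  have hconj : ∀ i v, qf (p - q) ((U i : Matrix (Fin d) (Fin d) ℂ)ᴴ *ᵥ v) =
      qf ((U i : Matrix (Fin d) (Fin d) ℂ) * (p - q) * (U i : Matrix (Fin d) (Fin d) ℂ)ᴴ) v :=
    fun i v => by rw [qf_mulVec, Matrix.conjTranspose_conjTranspose]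
  have hall := sum_abs_qf_le_of_net (A := fun i =>
    (U i : Matrix (Fin d) (Fin d) ℂ) * (p - q) * (U i : Matrix (Fin d) (Fin d) ℂ)ᴴ) hN hN1
    (fun i v => by rw [← hconj]; exact hS.abs_qf_conjTranspose_mulVec_le (U i) v)
    (K := 12 * √d) (fun φ hφ => by simp only [← hconj]; exact hK φ hφ)
  simp only [← hconj] at hall
  rw [ensemble_sub, ← smul_sub]
  -- `1152 = 3 · 32 · 12`: the loss in `d ≤ 3m`, the net factor and the threshold.
  have hbound : 1 / (m : ℝ) * (32 * (12 * √(d : ℝ))) ≤ 1152 / √(d : ℝ) := by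
    have hdm' : (d : ℝ) ≤ 3 * m := by exact_mod_cast hdm
    rw [one_div_mul_eq_div, div_le_div_iff₀ hm0 hspos]
    have := Real.mul_self_sqrt hd0.le
    nlinarith
  refine le_trans (distNorm_LO_ensemble_le b U hd (B := 1 / (m : ℝ) * (32 * (12 * √(d : ℝ))))
    ?_ fun v => ?_) hbound
  · rw [hcast]
    have hr : IsSelfAdjoint (((1 / (m : ℝ) : ℝ) : ℂ)) := Complex.conj_ofReal _
    exact hr.smul hS.isHermitian
  · simp only [hcast, qf_ofReal_smul, abs_mul]
    rw [← Finset.mul_sum, abs_of_pos (by positivity), mul_assoc]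
    exact mul_le_mul_of_nonneg_left (hall v) (by positivity)

/-- A union bound over the net. The failure set is only included in a finite union, so its
measurability is never needed. -/
theorem measureReal_lt (h : IsProjectionPair m p q) (hd : 0 < d) (hdm : d ≤ 3 * m)
    {Ω : Type*} [MeasurableSpace Ω] (P : Measure Ω) [IsProbabilityMeasure P]
    (U : Fin d → Ω → Matrix.unitaryGroup (Fin d) ℂ)
    (hU : ∀ i, HasLaw (U i) (haarUnitary d) P) (hind : iIndepFun U P) :
    P.real {ω | ¬ distNorm (LO d) (ensemble b ((1 / (m : ℂ)) • p) (fun i => U i ω) -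
      ensemble b ((1 / (m : ℂ)) • q) (fun i => U i ω)) ≤ 1152 / √(d : ℝ)} <
      Real.exp (-1 * d) := by
  obtain ⟨N, hcard, hN1, hN⟩ := exists_net d
  have hS := h.isTracelessContraction_sub
  have hsub : {ω | ¬ distNorm (LO d) (ensemble b ((1 / (m : ℂ)) • p) (fun i => U i ω) -
      ensemble b ((1 / (m : ℂ)) • q) (fun i => U i ω)) ≤ 1152 / √(d : ℝ)} ⊆
      ⋃ φ ∈ N, {ω | 12 * √d ≤
        ∑ i, |qf (p - q) ((U i ω : Matrix (Fin d) (Fin d) ℂ)ᴴ *ᵥ φ)|} := by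
    intro ω hω
    by_contra hcon
    refine hω (h.distNorm_LO_le_of_net b (fun i => U i ω) hd hdm hN hN1 fun φ hφ => ?_)
    by_contra! hlt
    exact hcon (Set.mem_biUnion hφ hlt.le)
  calc _ ≤ P.real (⋃ φ ∈ N, {ω | 12 * √d ≤
        ∑ i, |qf (p - q) ((U i ω : Matrix (Fin d) (Fin d) ℂ)ᴴ *ᵥ φ)|}) :=
        measureReal_mono hsub (measure_ne_top _ _)
    _ ≤ ∑ φ ∈ N, P.real {ω | 12 * √d ≤
        ∑ i, |qf (p - q) ((U i ω : Matrix (Fin d) (Fin d) ℂ)ᴴ *ᵥ φ)|} :=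
        measureReal_biUnion_finset_le _ _
    _ ≤ ∑ _φ ∈ N, (2 * Real.exp (-(11 / 2))) ^ d :=
        Finset.sum_le_sum fun φ hφ => hS.measureReal_sum_abs_qf_ge_le hd hU hind φ (hN1 φ hφ)
    _ ≤ 25 ^ d * (2 * Real.exp (-(11 / 2))) ^ d := by
        rw [Finset.sum_const, nsmul_eq_mul]
        refine mul_le_mul_of_nonneg_right ?_ (by positivity)
        exact_mod_cast hcard
    _ = (50 * Real.exp (-(11 / 2))) ^ d := by rw [← mul_pow]; ring_nf
    _ < Real.exp (-1) ^ d := by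
        refine pow_lt_pow_left₀ ?_ (by positivity) hd.ne'
        have h1 : Real.exp (-(11 / 2)) = Real.exp (-1) * Real.exp (-(9 / 2)) := by
          rw [← Real.exp_add]; norm_num
        -- Already `2.7^4 > 53`; the 50 is `25 · 2`, from the net and the two signs.
        have h2 : (50 : ℝ) < Real.exp (9 / 2) := by
          have h3 : Real.exp 1 ^ 4 ≤ Real.exp (9 / 2) := by
            rw [← Real.exp_nat_mul]
            exact Real.exp_le_exp.2 (by norm_num)
          have h4 : (2.7 : ℝ) ^ 4 ≤ Real.exp 1 ^ 4 :=
            pow_le_pow_left₀ (by norm_num) (by linarith [Real.exp_one_gt_d9]) 4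
          refine lt_of_lt_of_le ?_ (h4.trans h3)
          norm_num
        rw [h1, Real.exp_neg (9 / 2), mul_left_comm]
        refine mul_lt_of_lt_one_right (Real.exp_pos _) ?_
        rw [← div_eq_mul_inv, div_lt_one (Real.exp_pos _)]
        exact h2
    _ = Real.exp (-1 * d) := by rw [← Real.exp_nat_mul, mul_comm]

/-- If every choice failed, the failure probability on the product of Haar measures would be one,
not below `exp(-d)`. -/
theorem exists_unitaries (h : IsProjectionPair m p q) (hd : 0 < d) (hdm : d ≤ 3 * m) :
    ∃ U : Fin d → Matrix.unitaryGroup (Fin d) ℂ,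
      distNorm (LO d) (ensemble b ((1 / (m : ℂ)) • p) U - ensemble b ((1 / (m : ℂ)) • q) U) ≤
        1152 / √(d : ℝ) := by
  by_contra! hcon
  have hlt := h.measureReal_lt b hd hdm (Measure.pi fun _ : Fin d => haarUnitary d)
    (fun i ω => ω i)
    (fun i => ⟨(measurable_pi_apply i).aemeasurable, (measurePreserving_eval _ i).map_eq⟩)
    (iIndepFun_pi (X := fun _ => id) fun _ => aemeasurable_id)
  have huniv : {ω : Fin d → Matrix.unitaryGroup (Fin d) ℂ |
      ¬ distNorm (LO d) (ensemble b ((1 / (m : ℂ)) • p) (fun i => ω i) -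
        ensemble b ((1 / (m : ℂ)) • q) (fun i => ω i)) ≤ 1152 / √(d : ℝ)} = Set.univ :=
    Set.eq_univ_of_forall fun ω => not_le.2 (hcon ω)
  rw [huniv, probReal_univ] at hlt
  have : Real.exp (-1 * d) ≤ 1 := Real.exp_le_one_iff.2 (by
    have : (0 : ℝ) ≤ d := Nat.cast_nonneg d
    linarith)
  linarith

end IsProjectionPair

end Ensemble

/-! ### Projection pairs from coordinates and from subspaces -/

section Projections

variable {d : ℕ}

theorem isStarProjection_diagonal_ite (s : Finset (Fin d)) :
    IsStarProjection (Matrix.diagonal fun i => if i ∈ s then (1 : ℂ) else 0) := by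
  refine ⟨?_, ?_⟩
  · rw [IsIdempotentElem, Matrix.diagonal_mul_diagonal]
    congr 1
    ext i
    simp
  · rw [IsSelfAdjoint, Matrix.star_eq_conjTranspose, Matrix.diagonal_conjTranspose]
    congr 1
    ext i
    simp [apply_ite]

/-- Two disjoint sets of `⌊d/2⌋` coordinates; for odd `d` one coordinate is left over, so the two
projections need not be complementary. -/
theorem exists_isProjectionPair (hd : 2 ≤ d) :
    ∃ p q : Matrix (Fin d) (Fin d) ℂ, IsProjectionPair (d / 2) p q := by
  obtain ⟨s, -, hs⟩ := Finset.exists_subset_card_eq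
    (s := (Finset.univ : Finset (Fin d))) (n := d / 2) (by simp; omega)
  obtain ⟨t, hts, ht⟩ := Finset.exists_subset_card_eq (s := sᶜ) (n := d / 2) (by
    rw [Finset.card_compl, hs, Fintype.card_fin]; omega)
  refine ⟨_, _, ⟨by omega, isStarProjection_diagonal_ite s, isStarProjection_diagonal_ite t,
    ?_, ?_, ?_⟩⟩
  · rw [Matrix.diagonal_mul_diagonal, Matrix.diagonal_eq_zero]
    ext i
    by_cases hi : i ∈ s
    · have : i ∉ t := fun h => Finset.mem_compl.1 (hts h) hi
      simp [this]
    · simp [hi]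
  · simp [Matrix.trace_diagonal, hs]
  · simp [Matrix.trace_diagonal, ht]

variable (E : Submodule ℂ (EuclideanSpace ℂ (Fin d)))

theorem isStarProjection_projMatrix : IsStarProjection (projMatrix E) := by
  have h := isStarProjection_starProjection (U := E)
  refine ⟨?_, ?_⟩
  · rw [IsIdempotentElem, projMatrix, ← map_mul, h.isIdempotentElem.eq]
  · rw [IsSelfAdjoint, projMatrix]
    have h1 := (Matrix.toEuclideanCLM (n := Fin d) (𝕜 := ℂ)).symm.toStarRingEquiv.map_star'
      E.starProjection
    exact h1.symm.trans (congrArg _ h.isSelfAdjoint.star_eq)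

theorem projMatrix_orthogonal : projMatrix Eᗮ = 1 - projMatrix E := by
  rw [projMatrix, projMatrix, Submodule.starProjection_orthogonal', map_sub, map_one]

theorem trace_projMatrix : (projMatrix E).trace = Module.finrank ℂ E := by
  have h1 : Matrix.toLin (EuclideanSpace.basisFun (Fin d) ℂ).toBasis
      (EuclideanSpace.basisFun (Fin d) ℂ).toBasis (projMatrix E) = E.starProjection.toLinearMap := by
    have h2 : Matrix.toEuclideanCLM (n := Fin d) (𝕜 := ℂ) (projMatrix E) = E.starProjection :=
      StarAlgEquiv.apply_symm_apply _ _
    rw [← h2]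
    rfl
  rw [← Matrix.trace_toLin_eq _ (EuclideanSpace.basisFun (Fin d) ℂ).toBasis, h1]
  have hproj : LinearMap.IsProj E E.starProjection.toLinearMap :=
    ⟨fun x => E.starProjection_apply_mem x, fun x hx => E.starProjection_eq_self_iff.2 hx⟩
  exact hproj.trace

theorem isProjectionPair_projMatrix (hd : 0 < d) (hev : Even d)
    (hE : Module.finrank ℂ E = d / 2) :
    IsProjectionPair (d / 2) (projMatrix E) (projMatrix Eᗮ) := by
  obtain ⟨k, rfl⟩ := hev
  refine ⟨by omega, isStarProjection_projMatrix E, isStarProjection_projMatrix _, ?_, ?_, ?_⟩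
  · rw [projMatrix_orthogonal]
    exact (isStarProjection_projMatrix E).mul_one_sub_self
  · rw [trace_projMatrix, hE]
  · rw [trace_projMatrix]
    have := Submodule.finrank_add_finrank_orthogonal E
    rw [finrank_euclideanSpace_fin] at this
    congr 1
    omega

end Projections

theorem ensembleState_eq {d : ℕ} (hev : Even d)
    (b : OrthonormalBasis (Fin d) ℂ (EuclideanSpace ℂ (Fin d)))
    (E : Submodule ℂ (EuclideanSpace ℂ (Fin d))) (U : Fin d → Matrix.unitaryGroup (Fin d) ℂ) :
    ensembleState b E U = ensemble b ((1 / ((d / 2 : ℕ) : ℂ)) • projMatrix E) U := by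
  have h : ((d / 2 : ℕ) : ℂ) = (d : ℂ) / 2 := by
    rw [Nat.cast_div hev.two_dvd (by norm_num), Nat.cast_ofNat]
  rw [h]
  rfl

end

/-! ### The main theorem -/

theorem theorem3 : ∃ C c₀ : ℝ, 0 < C ∧ 0 < c₀ ∧
    (∀ d : ℕ, 2 ≤ d → ∃ ρ σ : Matrix (Fin d × Fin d) (Fin d × Fin d) ℂ,
      IsState ρ ∧ IsState σ ∧
      distNorm (LOCCOneWay d) (ρ - σ) = 2 ∧
      distNorm (LO d) (ρ - σ) ≤ C / √(d : ℝ)) ∧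
    (∀ d : ℕ, 0 < d → Even d →
      ∀ (E : Submodule ℂ (EuclideanSpace ℂ (Fin d))), Module.finrank ℂ E = d / 2 →
      ∀ (b : OrthonormalBasis (Fin d) ℂ (EuclideanSpace ℂ (Fin d))),
      (∀ U : Fin d → Matrix.unitaryGroup (Fin d) ℂ,
        IsState (ensembleState b E U) ∧ IsState (ensembleState b Eᗮ U) ∧
        distNorm (LOCCOneWay d) (ensembleState b E U - ensembleState b Eᗮ U) = 2) ∧
      ∀ (Ω : Type*) [MeasurableSpace Ω] (P : Measure Ω) [IsProbabilityMeasure P]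
        (U : Fin d → Ω → Matrix.unitaryGroup (Fin d) ℂ),
        (∀ i, HasLaw (U i) (haarUnitary d) P) → iIndepFun U P →
        P.real {ω | ¬ distNorm (LO d)
            (ensembleState b E (fun i => U i ω) - ensembleState b Eᗮ (fun i => U i ω))
              ≤ C / √(d : ℝ)} < Real.exp (-c₀ * d)) := by
  refine ⟨1152, 1, by norm_num, one_pos, fun d hd => ?_, fun d hd hev E hE b => ⟨fun U => ?_, ?_⟩⟩
  · obtain ⟨p, q, h⟩ := exists_isProjectionPair hd
    -- The inequality `d ≤ 3⌊d/2⌋` is tight at `d = 3`.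
    obtain ⟨U, hU⟩ := h.exists_unitaries (EuclideanSpace.basisFun (Fin d) ℂ) (by omega) (by omega)
    exact ⟨_, _, h.isState_left _ U (by omega), h.isState_right _ U (by omega),
      h.distNorm_LOCCOneWay _ U (by omega), hU⟩
  · have h := isProjectionPair_projMatrix E hd hev hE
    rw [ensembleState_eq hev, ensembleState_eq hev]
    exact ⟨h.isState_left b U hd, h.isState_right b U hd, h.distNorm_LOCCOneWay b U hd⟩
  · intro Ω _ P _ U hU hind
    have h := isProjectionPair_projMatrix E hd hev hE
    simp only [ensembleState_eq hev]
    exact h.measureReal_lt b hd (by have := hev.two_dvd; omega) P U hU hind
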